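/- Let $n\ge 1$. Let $B(A_n)$ be the group generated by $\sigma_1,\dots,\sigma_n$ with relations $\sigma_i\sigma_j=\sigma_j\sigma_i$ for $|i-j|\ge 2$ and $\sigma_i\sigma_{i+1}\sigma_i=\sigma_{i+1}\sigma_i\sigma_{i+1}$ for $1\le i\le n-1$. Let $B(B_{n+1})$ be the group generated by $\sigma_1,\dots,\sigma_n,t$ with these relations together with $\sigma_it=t\sigma_i$ for $2\le i\le n$ and $\sigma_1t\sigma_1t=t\sigma_1t\sigma_1$. Let $B(\tilde A_n)$ be the group generated by $\sigma_1,\dots,\sigma_n,a_{n+1}$ with the relations of $B(A_n)$ together with $\sigma_ia_{n+1}=a_{n+1}\sigma_i$ for $2\le i\le n-1$ and, if $n\ge 2$, $\sigma_ia_{n+1}\sigma_i=a_{n+1}\sigma_ia_{n+1}$ for $i=1$ and $i=n$ (so $B(\tilde A_1)$ is free on $\sigma_1,a_2$). Let $f:B(\tilde A_n)\to B(A_n)$ be the homomorphism with $\sigma_i\mapsto\sigma_i$ and $a_{n+1}\mapsto\sigma_n^{-1}\cdots\sigma_2^{-1}\sigma_1\sigma_2\cdots\sigma_n$, let $\alpha_n:B(B_{n+1})\to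 B(A_n)$ be the homomorphism with $\sigma_i\mapsto\sigma_i$ and $t\mapsto 1$, and let $i_n:B(\tilde A_n)\to B(B_{n+1})$ be the homomorphism with $\sigma_i\mapsto\sigma_i$ and $a_{n+1}\mapsto\phi\sigma_n\phi^{-1}$, where $\phi=t\sigma_1\cdots\sigma_n$. Let $N_e$ be the normal subgroup of $B(\tilde A_n)$ generated by $e=a_{n+1}^{-1}\sigma_n^{-1}\cdots\sigma_2^{-1}\sigma_1\sigma_2\cdots\sigma_n$. In $B(B_{n+1})$ put $F_0=t$ and $F_i=\sigma_i\cdots\sigma_1t\sigma_1^{-1}\cdots\sigma_i^{-1}$ for $1\le i\le n$. Then: 1. $f$ is surjective with kernel $N_e$; $i_n$ is injective and $\alpha_n\circ i_n=f$. 2. $\ker(\alpha_n)$ is a free group with free generators $F_0,F_1,\dots,F_n$. 3. $i_n(N_e)$ is the exponent-sum-zero subgroup of $\ker(\alpha_n)$, that is $$i_n(N_e)=\Big\{F_{i_1}^{\epsilon_1}\cdots F_{i_m}^{\epsilon_m}\ :\ m\ge 0,\ 0\le i_k\le n,\ \epsilon_k\in\mathbb Z,\ \sum_k\epsilon_k=0\Big\}.$$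 4. $N_e$ is a free group which is not finitely generated. Identified with its image under $i_n$, it has the free generators $F_0^{\,j}F_iF_0^{-(j+1)}$, $j\in\mathbb Z$, $1\le i\le n$ (distinct pairs $(j,i)$ giving distinct generators). -/

import Mathlib

namespace AffineBraid

section Words

variable {G : Type*} [Group G]

/-- The word `x y (y x)⁻¹`: as a relator it says that `x` and `y` commute. -/
def commRel (x y : G) : G := x * y * (y * x)⁻¹

/-- The word `x y x (y x y)⁻¹`: as a relator it is the braid relation of length three. -/
def braidRel (x y : G) : G := x * y * x * (y * x * y)⁻¹

/-- The word `x y x y (y x y x)⁻¹`: as a relator it is the braid relation of length four. -/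
def braidRel4 (x y : G) : G := x * y * x * y * (y * x * y * x)⁻¹

/-- `s₁ s₂ ⋯ sₙ`, where `s i` (for `i = 0, …, n - 1`) stands for `s_{i+1}`. -/
def ascProd {n : ℕ} (s : Fin n → G) : G := (List.ofFn s).prod

/-- The index of the last member `sₙ` of a family `s₁, …, sₙ` with `n ≥ 1`. -/
def lastIdx (n : ℕ) [NeZero n] : Fin n := ⟨n - 1, Nat.sub_one_lt (NeZero.ne n)⟩

/-- `sₙ⁻¹ ⋯ s₂⁻¹ s₁ s₂ ⋯ sₙ`, written as `(s₁ ⋯ sₙ)⁻¹ s₁ (s₁ ⋯ sₙ)`. -/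
def bWord {n : ℕ} [NeZero n] (s : Fin n → G) : G := (ascProd s)⁻¹ * s 0 * ascProd s

end Words

/-! ### The three braid groups -/

/-- Relators of the braid group of type `Aₙ`; the generator `i : Fin n` is `σ_{i+1}`. -/
inductive ARel (n : ℕ) : FreeGroup (Fin n) → Prop
  | comm (i j : Fin n) (h : i.val + 2 ≤ j.val) :
      ARel n (commRel (FreeGroup.of i) (FreeGroup.of j))
  | braid (i j : Fin n) (h : i.val + 1 = j.val) :
      ARel n (braidRel (FreeGroup.of i) (FreeGroup.of j))

/-- The braid group of type `Aₙ`, on `σ₁, …, σₙ`. -/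
abbrev BraidA (n : ℕ) : Type := PresentedGroup {r | ARel n r}

/-- Generators `σ₁, …, σₙ, t` of the braid group of type `B_{n+1}`. -/
inductive BGen (n : ℕ) : Type
  | sigma (i : Fin n) : BGen n
  | t : BGen n

/-- Relators of the braid group of type `B_{n+1}`. -/
inductive BRel (n : ℕ) : FreeGroup (BGen n) → Prop
  | comm (i j : Fin n) (h : i.val + 2 ≤ j.val) :
      BRel n (commRel (FreeGroup.of (BGen.sigma i)) (FreeGroup.of (BGen.sigma j)))
  | braid (i j : Fin n) (h : i.val + 1 = j.val) :
      BRel n (braidRel (FreeGroup.of (BGen.sigma i)) (FreeGroup.of (BGen.sigma j)))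
  | comm_t (i : Fin n) (h : 1 ≤ i.val) :
      BRel n (commRel (FreeGroup.of (BGen.sigma i)) (FreeGroup.of BGen.t))
  | braid_t (i : Fin n) (h : i.val = 0) :
      BRel n (braidRel4 (FreeGroup.of (BGen.sigma i)) (FreeGroup.of BGen.t))

/-- The braid group of type `B_{n+1}`, on `σ₁, …, σₙ, t`. -/
abbrev BraidB (n : ℕ) : Type := PresentedGroup {r | BRel n r}

/-- Generators `σ₁, …, σₙ, a_{n+1}` of the braid group of type `Ãₙ`. -/
inductive AffGen (n : ℕ) : Type
  | sigma (i : Fin n) : AffGen n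
  | a : AffGen n

/-- Relators of the braid group of type `Ãₙ`. There is none for `n = 1`: the braid group of
type `Ã₁` is free on `σ₁, a₂`. -/
inductive AffRel (n : ℕ) : FreeGroup (AffGen n) → Prop
  | comm (i j : Fin n) (h : i.val + 2 ≤ j.val) :
      AffRel n (commRel (FreeGroup.of (AffGen.sigma i)) (FreeGroup.of (AffGen.sigma j)))
  | braid (i j : Fin n) (h : i.val + 1 = j.val) :
      AffRel n (braidRel (FreeGroup.of (AffGen.sigma i)) (FreeGroup.of (AffGen.sigma j)))
  | comm_a (i : Fin n) (h₁ : 1 ≤ i.val) (h₂ : i.val + 2 ≤ n) :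
      AffRel n (commRel (FreeGroup.of (AffGen.sigma i)) (FreeGroup.of AffGen.a))
  | braid_first (i : Fin n) (hn : 2 ≤ n) (h : i.val = 0) :
      AffRel n (braidRel (FreeGroup.of (AffGen.sigma i)) (FreeGroup.of AffGen.a))
  | braid_last (i : Fin n) (hn : 2 ≤ n) (h : i.val + 1 = n) :
      AffRel n (braidRel (FreeGroup.of (AffGen.sigma i)) (FreeGroup.of AffGen.a))

/-- The braid group of type `Ãₙ`, on `σ₁, …, σₙ, a_{n+1}`. -/
abbrev BraidAff (n : ℕ) : Type := PresentedGroup {r | AffRel n r}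

/-- `σ_{i+1}` in type `Aₙ`. -/
def sigmaA {n : ℕ} (i : Fin n) : BraidA n := PresentedGroup.of i

/-- `σ_{i+1}` in type `B_{n+1}`. -/
def sigmaB {n : ℕ} (i : Fin n) : BraidB n := PresentedGroup.of (BGen.sigma i)

/-- `t` in type `B_{n+1}`. -/
def tB (n : ℕ) : BraidB n := PresentedGroup.of BGen.t

/-- `σ_{i+1}` in type `Ãₙ`. -/
def sigmaAff {n : ℕ} (i : Fin n) : BraidAff n := PresentedGroup.of (AffGen.sigma i)

/-- `a_{n+1}` in type `Ãₙ`. -/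
def aAff (n : ℕ) : BraidAff n := PresentedGroup.of AffGen.a

/-- `φ_{n+1} = t σ₁ ⋯ σₙ`. -/
def phiB (n : ℕ) : BraidB n := tB n * ascProd sigmaB

/-! ### Auxiliary identities: the homomorphisms below respect the relators -/

section Aux

variable {G : Type*} [Group G]

/-- Two elements satisfy the braid relation of length three. -/
def Br (x y : G) : Prop := x * y * x = y * x * y

/-- A family satisfies the relations of type `Aₙ`. -/
structure BraidFam {n : ℕ} (s : Fin n → G) : Prop where
  comm : ∀ i j : Fin n, i.val + 2 ≤ j.val → s i * s j = s j * s i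
  braid : ∀ i j : Fin n, i.val + 1 = j.val → Br (s i) (s j)

theorem commRel_eq_one {x y : G} : commRel x y = 1 ↔ x * y = y * x := mul_inv_eq_one
theorem braidRel_eq_one {x y : G} : braidRel x y = 1 ↔ Br x y := mul_inv_eq_one
theorem braidRel4_eq_one {x y : G} : braidRel4 x y = 1 ↔ x * y * x * y = y * x * y * x :=
  mul_inv_eq_one

theorem map_commRel {H : Type*} [Group H] (f : G →* H) (x y : G) :
    f (commRel x y) = commRel (f x) (f y) := by simp [commRel]
theorem map_braidRel {H : Type*} [Group H] (f : G →* H) (x y : G) :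
    f (braidRel x y) = braidRel (f x) (f y) := by simp [braidRel]
theorem map_braidRel4 {H : Type*} [Group H] (f : G →* H) (x y : G) :
    f (braidRel4 x y) = braidRel4 (f x) (f y) := by simp [braidRel4]

theorem Br.symm {x y : G} (h : Br x y) : Br y x := Eq.symm h

theorem Br.conj {x y : G} (h : Br x y) (g : G) : Br (g * x * g⁻¹) (g * y * g⁻¹) := by
  unfold Br at *
  calc _ = g * (x * y * x) * g⁻¹ := by group
    _ = g * (y * x * y) * g⁻¹ := by rw [h]
    _ = _ := by group

theorem conj_fix {x g : G} (h : x * g = g * x) : g * x * g⁻¹ = x := by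
  rw [← h]; group

theorem Br.conj_left {x y g : G} (h : Br x y) (hg : y * g = g * y) : Br (g * x * g⁻¹) y := by
  have := h.conj g
  rwa [conj_fix hg] at this

/-- `x y x⁻¹ = y⁻¹ x y`. -/
theorem Br.conj_eq {x y : G} (h : Br x y) : x * y * x⁻¹ = y⁻¹ * x * y := by
  unfold Br at h
  calc x * y * x⁻¹ = y⁻¹ * (y * x * y) * x⁻¹ := by group
    _ = y⁻¹ * (x * y * x) * x⁻¹ := by rw [h]
    _ = _ := by group

theorem BraidFam.castSucc {n : ℕ} {s : Fin (n + 1) → G} (h : BraidFam s) :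
    BraidFam (fun i : Fin n => s i.castSucc) :=
  ⟨fun _ _ hij => h.comm _ _ hij, fun _ _ hij => h.braid _ _ hij⟩

theorem ascProd_succ {n : ℕ} (s : Fin (n + 1) → G) :
    ascProd s = ascProd (fun i : Fin n => s i.castSucc) * s (Fin.last n) := by
  rw [ascProd, List.ofFn_succ']
  simp [ascProd]

theorem ascProd_commute {n : ℕ} (s : Fin n → G) (g : G) (h : ∀ i, g * s i = s i * g) :
    g * ascProd s = ascProd s * g := by
  have : Commute g (List.ofFn s).prod := by
    apply Commute.list_prod_right
    intro x hx
    obtain ⟨i, rfl⟩ := (List.mem_ofFn' s x).1 hx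
    exact h i
  exact this

theorem bWord_succ {n : ℕ} (s : Fin (n + 2) → G) :
    bWord s = (s (Fin.last (n + 1)))⁻¹ * bWord (fun i : Fin (n + 1) => s i.castSucc) *
      s (Fin.last (n + 1)) := by
  unfold bWord
  rw [ascProd_succ]
  simp only [Fin.castSucc_zero]
  group

theorem bWord_one (s : Fin 1 → G) : bWord s = s 0 := by
  simp [bWord, ascProd]

/-- An element commuting with all members of a family commutes with `bWord`. -/
theorem bWord_commute {n : ℕ} [NeZero n] (s : Fin n → G) (g : G)
    (h : ∀ i, g * s i = s i * g) : g * bWord s = bWord s * g := by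
  have h1 : Commute g (ascProd s) := ascProd_commute s g h
  have h2 : Commute g (s 0) := h 0
  exact ((h1.inv_right.mul_right h2).mul_right h1)

theorem bWord_braid_next {n : ℕ} (s : Fin (n + 2) → G) (h : BraidFam s) :
    Br (bWord (fun i : Fin (n + 1) => s i.castSucc)) (s (Fin.last (n + 1))) := by
  induction n with
  | zero => rw [bWord_one]; exact h.braid _ _ rfl
  | succ n ih =>
    have h1 := ih _ h.castSucc
    rw [bWord_succ, ← h1.conj_eq]
    have h2 := h.braid (Fin.last (n + 1)).castSucc (Fin.last (n + 2)) rfl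
    apply h2.conj_left
    apply bWord_commute
    intro i
    refine (h.comm _ _ ?_).symm
    simp only [Fin.val_castSucc, Fin.val_last]
    omega

theorem bWord_braid_last {n : ℕ} (s : Fin (n + 2) → G) (h : BraidFam s) :
    Br (s (Fin.last (n + 1))) (bWord s) := by
  rw [bWord_succ]
  have := (bWord_braid_next s h).conj (s (Fin.last (n + 1)))⁻¹
  simpa using this.symm

theorem ascProd_shift {n : ℕ} (s : Fin n → G) (h : BraidFam s) (i j : Fin n)
    (hij : i.val + 1 = j.val) : ascProd s * s i = s j * ascProd s := by
  induction n with
  | zero => exact i.elim0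
  | succ n ih =>
    have hi : i.val < n := by omega
    obtain ⟨i', rfl⟩ : ∃ i' : Fin n, i = i'.castSucc := ⟨⟨i.val, hi⟩, rfl⟩
    rw [Fin.val_castSucc] at hij hi
    rcases Fin.eq_castSucc_or_eq_last j with ⟨j', rfl⟩ | rfl
    · have h1 := ih _ h.castSucc i' j' hij
      have h2 := h.comm i'.castSucc (Fin.last n) (by
        simp only [Fin.val_castSucc, Fin.val_last] at *; omega)
      rw [ascProd_succ, mul_assoc, ← h2, ← mul_assoc, h1, mul_assoc]
    · rw [Fin.val_last] at hij
      obtain ⟨m, rfl⟩ : ∃ m, n = m + 1 := ⟨i'.val, hij.symm⟩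
      obtain rfl : i' = Fin.last m := Fin.ext (by simp only [Fin.val_last]; omega)
      have h1 : Br (s (Fin.last m).castSucc) (s (Fin.last (m + 1))) := h.braid _ _ rfl
      have h2 := ascProd_commute (fun i : Fin m => s i.castSucc.castSucc) (s (Fin.last (m + 1)))
        (fun i => (h.comm _ _ (by
          have := i.isLt
          simp only [Fin.val_castSucc, Fin.val_last]; omega)).symm)
      unfold Br at h1
      rw [ascProd_succ, ascProd_succ]
      set Q := ascProd (fun i : Fin m => s i.castSucc.castSucc)
      calc _ = Q * (s (Fin.last m).castSucc * s (Fin.last (m + 1)) * s (Fin.last m).castSucc) := by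
            group
        _ = (Q * s (Fin.last (m + 1))) * s (Fin.last m).castSucc * s (Fin.last (m + 1)) := by
            rw [h1]; group
        _ = _ := by rw [← h2]; group

theorem ascProd_conj {n : ℕ} (s : Fin n → G) (h : BraidFam s) (i j : Fin n)
    (hij : i.val + 1 = j.val) : (ascProd s)⁻¹ * s j * ascProd s = s i := by
  rw [mul_assoc, ← ascProd_shift s h i j hij]; group

theorem bWord_comm_mid {n : ℕ} [NeZero n] (s : Fin n → G) (h : BraidFam s) (i : Fin n)
    (h₁ : 1 ≤ i.val) (h₂ : i.val + 2 ≤ n) : s i * bWord s = bWord s * s i := by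
  have h3 : s 0 * s ⟨i.val + 1, by omega⟩ = s ⟨i.val + 1, by omega⟩ * s 0 :=
    h.comm _ _ (by simp only [Fin.val_zero]; omega)
  rw [← ascProd_conj s h i ⟨i.val + 1, by omega⟩ rfl, bWord]
  calc _ = (ascProd s)⁻¹ * (s ⟨i.val + 1, by omega⟩ * s 0) * ascProd s := by group
    _ = (ascProd s)⁻¹ * (s 0 * s ⟨i.val + 1, by omega⟩) * ascProd s := by rw [h3]
    _ = _ := by group

theorem bWord_braid_first {n : ℕ} [NeZero n] (s : Fin n → G) (h : BraidFam s) (hn : 2 ≤ n) :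
    Br (s 0) (bWord s) := by
  have h1 : Br (s 0) (s ⟨1, hn⟩) := h.braid _ _ (by simp)
  have h2 := h1.symm.conj (ascProd s)⁻¹
  simp only [inv_inv] at h2
  rwa [ascProd_conj s h 0 ⟨1, hn⟩ (by simp)] at h2

theorem bWord_eq {n : ℕ} [NeZero n] (s : Fin n → G) (h : BraidFam s) :
    ascProd s * s (lastIdx n) * (ascProd s)⁻¹ = bWord s := by
  obtain ⟨m, rfl⟩ := Nat.exists_eq_succ_of_ne_zero (NeZero.ne n)
  have key : ∀ (m : ℕ) (s : Fin (m + 1) → G), BraidFam s →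
      ascProd s * s (Fin.last m) * (ascProd s)⁻¹ = bWord s := by
    intro m
    induction m with
    | zero => intro s _; simp [bWord, ascProd]
    | succ m ih =>
      intro s h
      have h1 : Br (s (Fin.last m).castSucc) (s (Fin.last (m + 1))) := h.braid _ _ rfl
      have h2 := ascProd_commute (fun i : Fin m => s i.castSucc.castSucc) (s (Fin.last (m + 1)))
        (fun i => (h.comm _ _ (by
          have := i.isLt
          simp only [Fin.val_castSucc, Fin.val_last]; omega)).symm)
      have h3 := h1.conj_eq
      rw [bWord_succ, ← ih _ h.castSucc, ascProd_succ s,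
        ascProd_succ (fun i : Fin (m + 1) => s i.castSucc)]
      set Q := ascProd (fun i : Fin m => s i.castSucc.castSucc)
      set x := s (Fin.last m).castSucc
      set y := s (Fin.last (m + 1))
      have h4 : Q * y⁻¹ = y⁻¹ * Q := by
        rw [mul_inv_eq_iff_eq_mul, mul_assoc, ← h2]; group
      have h5 : y * Q⁻¹ = Q⁻¹ * y := by
        rw [mul_inv_eq_iff_eq_mul, mul_assoc, h2]; group
      calc _ = Q * (x * y * x⁻¹) * Q⁻¹ := by group
        _ = (Q * y⁻¹) * x * (y * Q⁻¹) := by rw [h3]; group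
        _ = y⁻¹ * (Q * x * Q⁻¹) * y := by rw [h4, h5]; group
        _ = _ := by group
  exact key m s h

/-- In type `B`: conjugation by `φ = t s₁ ⋯ sₙ` shifts the generators cyclically. -/
theorem phi_shift {n : ℕ} [NeZero n] (s : Fin n → G) (h : BraidFam s) (t : G)
    (ht : ∀ i : Fin n, 1 ≤ i.val → s i * t = t * s i) (i j : Fin n)
    (hij : i.val + 1 = j.val) : (t * ascProd s) * s i * (t * ascProd s)⁻¹ = s j := by
  rw [mul_assoc t, ascProd_shift s h i j hij, ← mul_assoc, ← ht j (by omega)]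
  group

theorem phi_shift_last {n : ℕ} [NeZero n] (s : Fin n → G) (h : BraidFam s) (t : G)
    (ht : ∀ i : Fin n, 1 ≤ i.val → s i * t = t * s i)
    (ht0 : s 0 * t * s 0 * t = t * s 0 * t * s 0) :
    (t * ascProd s) * ((t * ascProd s) * s (lastIdx n) * (t * ascProd s)⁻¹) * (t * ascProd s)⁻¹
      = s 0 := by
  have h1 := bWord_eq s h
  have h2 : ascProd s * t * (ascProd s)⁻¹ = s 0 * t * (s 0)⁻¹ := by
    obtain ⟨m, rfl⟩ := Nat.exists_eq_succ_of_ne_zero (NeZero.ne n)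
    have h3 : ascProd s = s 0 * ascProd (fun i : Fin m => s i.succ) := by
      simp [ascProd, List.ofFn_succ]
    have h4 := ascProd_commute (fun i : Fin m => s i.succ) t
      (fun i => (ht i.succ (by simp)).symm)
    rw [h3]
    set w := ascProd (fun i : Fin m => s i.succ)
    calc _ = s 0 * (w * t) * w⁻¹ * (s 0)⁻¹ := by group
      _ = _ := by rw [← h4]; group
  set P := ascProd s
  set x := s 0
  calc _ = t * (P * t * P⁻¹) * (P * (P * s (lastIdx n) * P⁻¹) * P⁻¹) *
        (P * t * P⁻¹)⁻¹ * t⁻¹ := by group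
    _ = t * (x * t * x⁻¹) * x * (x * t * x⁻¹)⁻¹ * t⁻¹ := by
        rw [h1, h2]
        have : P * bWord s * P⁻¹ = x := by simp only [bWord, P, x]; group
        rw [this]
    _ = (t * x * t * x) * (t * x * t)⁻¹ := by group
    _ = x := by
        have h6 : t * x * t * x = x * (t * x * t) := by rw [← ht0]; group
        rw [h6]; group

end Aux

theorem braidFam_sigmaA (n : ℕ) : BraidFam (sigmaA : Fin n → BraidA n) where
  comm i j h := by
    have := PresentedGroup.one_of_mem (rels := {r | ARel n r}) (ARel.comm i j h)
    rw [map_commRel] at this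
    exact commRel_eq_one.1 this
  braid i j h := by
    have := PresentedGroup.one_of_mem (rels := {r | ARel n r}) (ARel.braid i j h)
    rw [map_braidRel] at this
    exact braidRel_eq_one.1 this

theorem braidFam_sigmaB (n : ℕ) : BraidFam (sigmaB : Fin n → BraidB n) where
  comm i j h := by
    have := PresentedGroup.one_of_mem (rels := {r | BRel n r}) (BRel.comm i j h)
    rw [map_commRel] at this
    exact commRel_eq_one.1 this
  braid i j h := by
    have := PresentedGroup.one_of_mem (rels := {r | BRel n r}) (BRel.braid i j h)
    rw [map_braidRel] at this
    exact braidRel_eq_one.1 this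

theorem sigmaB_comm_t (n : ℕ) (i : Fin n) (h : 1 ≤ i.val) :
    sigmaB i * tB n = tB n * sigmaB i := by
  have := PresentedGroup.one_of_mem (rels := {r | BRel n r}) (BRel.comm_t i h)
  rw [map_commRel] at this
  exact commRel_eq_one.1 this

theorem sigmaB_braid_t (n : ℕ) [NeZero n] :
    sigmaB 0 * tB n * sigmaB 0 * tB n = tB n * sigmaB 0 * tB n * sigmaB 0 := by
  have := PresentedGroup.one_of_mem (rels := {r | BRel n r}) (BRel.braid_t 0 (by simp))
  rw [map_braidRel4] at this
  exact braidRel4_eq_one.1 this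

/-! ### The homomorphisms -/

/-- Images of the generators under `B(Ãₙ) → B(Aₙ)`. -/
def fGen (n : ℕ) [NeZero n] : AffGen n → BraidA n
  | AffGen.sigma i => sigmaA i
  | AffGen.a => bWord sigmaA

theorem fGen_rel (n : ℕ) [NeZero n] :
    ∀ r ∈ {r | AffRel n r}, FreeGroup.lift (fGen n) r = 1 := by
  have hA := braidFam_sigmaA n
  intro r hr
  cases hr with
  | comm i j h =>
    rw [map_commRel, commRel_eq_one]; simpa [fGen] using hA.comm i j h
  | braid i j h =>
    rw [map_braidRel, braidRel_eq_one]; simpa [fGen] using hA.braid i j h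
  | comm_a i h₁ h₂ =>
    rw [map_commRel, commRel_eq_one]; simpa [fGen] using bWord_comm_mid _ hA i h₁ h₂
  | braid_first i hn h =>
    obtain rfl : i = 0 := Fin.ext (by simpa using h)
    rw [map_braidRel, braidRel_eq_one]; simpa [fGen] using bWord_braid_first _ hA hn
  | braid_last i hn h =>
    rw [map_braidRel, braidRel_eq_one]
    obtain ⟨m, rfl⟩ : ∃ m, n = m + 2 := ⟨n - 2, by omega⟩
    obtain rfl : i = Fin.last (m + 1) := Fin.ext (by simp only [Fin.val_last]; omega)
    simpa [fGen] using bWord_braid_last _ hA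

/-- The homomorphism `f : B(Ãₙ) → B(Aₙ)` with `σᵢ ↦ σᵢ` and
`a_{n+1} ↦ σₙ⁻¹ ⋯ σ₂⁻¹ σ₁ σ₂ ⋯ σₙ`. -/
def fHom (n : ℕ) [NeZero n] : BraidAff n →* BraidA n := PresentedGroup.toGroup (fGen_rel n)

/-- Images of the generators under `B(Ãₙ) → B(B_{n+1})`. -/
def iGen (n : ℕ) [NeZero n] : AffGen n → BraidB n
  | AffGen.sigma i => sigmaB i
  | AffGen.a => phiB n * sigmaB (lastIdx n) * (phiB n)⁻¹

theorem iGen_rel (n : ℕ) [NeZero n] :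
    ∀ r ∈ {r | AffRel n r}, FreeGroup.lift (iGen n) r = 1 := by
  have hB := braidFam_sigmaB n
  have hs := phi_shift _ hB (tB n) (sigmaB_comm_t n)
  have hl := phi_shift_last _ hB (tB n) (sigmaB_comm_t n) (sigmaB_braid_t n)
  change ∀ i j : Fin n, i.val + 1 = j.val → phiB n * sigmaB i * (phiB n)⁻¹ = sigmaB j at hs
  change phiB n * (phiB n * sigmaB (lastIdx n) * (phiB n)⁻¹) * (phiB n)⁻¹ = sigmaB 0 at hl
  intro r hr
  cases hr with
  | comm i j h =>
    rw [map_commRel, commRel_eq_one]; simpa [iGen] using hB.comm i j h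
  | braid i j h =>
    rw [map_braidRel, braidRel_eq_one]; simpa [iGen] using hB.braid i j h
  | comm_a i h₁ h₂ =>
    rw [map_commRel, commRel_eq_one]
    simp only [FreeGroup.lift_apply_of, iGen]
    rw [← hs ⟨i.val - 1, by omega⟩ i (by simp only; omega)]
    have h3 := hB.comm ⟨i.val - 1, by omega⟩ (lastIdx n) (by simp only [lastIdx]; omega)
    calc _ = phiB n * (sigmaB ⟨i.val - 1, by omega⟩ * sigmaB (lastIdx n)) * (phiB n)⁻¹ := by group
      _ = phiB n * (sigmaB (lastIdx n) * sigmaB ⟨i.val - 1, by omega⟩) * (phiB n)⁻¹ := by rw [h3]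
      _ = _ := by group
  | braid_first i hn h =>
    obtain rfl : i = 0 := Fin.ext (by simpa using h)
    rw [map_braidRel, braidRel_eq_one]
    simp only [FreeGroup.lift_apply_of, iGen]
    have h3 : Br (phiB n * sigmaB 0 * (phiB n)⁻¹)
        (phiB n * (phiB n * sigmaB (lastIdx n) * (phiB n)⁻¹) * (phiB n)⁻¹) := by
      rw [hl, hs 0 ⟨1, hn⟩ (by simp)]
      exact (hB.braid _ _ (by simp)).symm
    have h4 := h3.conj (phiB n)⁻¹
    have e : ∀ x g : BraidB n, g⁻¹ * (g * x * g⁻¹) * g⁻¹⁻¹ = x := fun x g => by group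
    rwa [e, e] at h4
  | braid_last i hn h =>
    rw [map_braidRel, braidRel_eq_one]
    obtain rfl : i = lastIdx n := Fin.ext (by simp only [lastIdx]; omega)
    simp only [FreeGroup.lift_apply_of, iGen]
    have h3 : Br (sigmaB ⟨n - 2, by omega⟩) (sigmaB (lastIdx n)) :=
      hB.braid _ _ (by simp only [lastIdx]; omega)
    have h4 := h3.conj (phiB n)
    rwa [hs ⟨n - 2, by omega⟩ (lastIdx n) (by simp only [lastIdx]; omega)] at h4

/-- The homomorphism `i : B(Ãₙ) → B(B_{n+1})` with `σᵢ ↦ σᵢ` and `a_{n+1} ↦ φ σₙ φ⁻¹`, where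
`φ = t σ₁ ⋯ σₙ`. -/
def iHom (n : ℕ) [NeZero n] : BraidAff n →* BraidB n := PresentedGroup.toGroup (iGen_rel n)

/-- Images of the generators under `B(B_{n+1}) → B(Aₙ)`. -/
def alphaGen (n : ℕ) : BGen n → BraidA n
  | BGen.sigma i => sigmaA i
  | BGen.t => 1

theorem alphaGen_rel (n : ℕ) : ∀ r ∈ {r | BRel n r}, FreeGroup.lift (alphaGen n) r = 1 := by
  have hA := braidFam_sigmaA n
  intro r hr
  cases hr with
  | comm i j h =>
    rw [map_commRel, commRel_eq_one]; simpa [alphaGen] using hA.comm i j h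
  | braid i j h =>
    rw [map_braidRel, braidRel_eq_one]; simpa [alphaGen] using hA.braid i j h
  | comm_t i h =>
    rw [map_commRel, commRel_eq_one]; simp [alphaGen]
  | braid_t i h =>
    rw [map_braidRel4, braidRel4_eq_one]; simp [alphaGen]

/-- The homomorphism `α : B(B_{n+1}) → B(Aₙ)` with `σᵢ ↦ σᵢ` and `t ↦ 1`. -/
def alphaHom (n : ℕ) : BraidB n →* BraidA n := PresentedGroup.toGroup (alphaGen_rel n)

/-! ### The subgroup `N_e` and the elements `F_i` -/

/-- `e = a_{n+1}⁻¹ σₙ⁻¹ ⋯ σ₂⁻¹ σ₁ σ₂ ⋯ σₙ` in `B(Ãₙ)`. -/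
def eElt (n : ℕ) [NeZero n] : BraidAff n := (aAff n)⁻¹ * bWord sigmaAff

/-- `N_e`, the normal subgroup of `B(Ãₙ)` generated by `e`. -/
def NSub (n : ℕ) [NeZero n] : Subgroup (BraidAff n) := Subgroup.normalClosure {eElt n}

/-- `F_i = σ_i ⋯ σ₁ t σ₁⁻¹ ⋯ σ_i⁻¹` in `B(B_{n+1})` for `0 ≤ i ≤ n`, that is `F₀ = t` and
`F_{i+1} = σ_{i+1} F_i σ_{i+1}⁻¹`. -/
def FElt (n : ℕ) : Fin (n + 1) → BraidB n :=
  Fin.induction (tB n) (fun i F => sigmaB i * F * (sigmaB i)⁻¹)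

/-- The elements `F_{i₁}^{ε₁} ⋯ F_{i_m}^{ε_m}` with `ε₁ + ⋯ + ε_m = 0`. -/
def exponentSumZero {ι G : Type*} [Group G] (F : ι → G) : Set G :=
  {x | ∃ w : List (ι × ℤ), (w.map Prod.snd).sum = 0 ∧ x = (w.map fun p => F p.1 ^ p.2).prod}

end AffineBraid

open AffineBraid

/-! The group B(B_{n+1}) splits as a semidirect product in two ways, and N_e is the intersection of
the two normal factors. First, conjugation by the `σ_i` permutes and conjugates the `F_k` by Artin's
formulas, so B(B_{n+1}) ≅ F_{n+1} ⋊ B(Aₙ), the free group being generated by the `F_k` and the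
projection being α. This gives the free basis of ker α (`freeHom_spec`). Secondly, conjugation by φ
= tσ₁⋯σₙ rotates σ₁, …, σₙ, a_{n+1} cyclically, so B(B_{n+1}) ≅ B(Ãₙ) ⋊ ℤ with φ generating ℤ. The
inclusion of the normal factor is i, and the projection to ℤ is the t-exponent sum (`iHom_spec`).
Modulo e the generator a_{n+1} becomes redundant and B(Aₙ) maps back onto the quotient, so ker f =
N_e (`ker_fHom`). As α ∘ i = f, the image of N_e is ker α ∩ im i, the elements of ker α of t-degree
zero. Each `F_k` is conjugate to t, so there the t-degree is the exponent sum (`map_NSub_iHom`).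
Finally the exponent sum on F_{n+1} is split by x₀, whose conjugation translates the index j of x₀ʲ
x_k x₀^{-(j+1)}; this exhibits F_{n+1} as Free(ℤ × {1, …, n}) ⋊ ℤ and yields the infinite basis
(`sumZeroHom_spec`). All three splittings rest on `injective_and_range_of_retract`, which needs only
maps in both directions checked on generators. -/

namespace AffineBraid

open SemidirectProduct

/-! ### Semidirect products recognised through retracts; free bases -/

section SplitExtensions

variable {G N Q : Type*} [Group G] [Group N] [Group Q] {φ : Q →* MulAut N}

/-- The compatibility condition for a homomorphism out of a semidirect product can be checked on
generators of the acting group. -/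
theorem comp_act_eq_conj_comp {f : N →* G} {k : Q →* G} {S : Set Q}
    (hS : Subgroup.closure S = ⊤) (h : ∀ s ∈ S, ∀ x, f (φ s x) = k s * f x * (k s)⁻¹) (g : Q) :
    f.comp (φ g).toMonoidHom = (MulAut.conj (k g)).toMonoidHom.comp f := by
  have key : ∀ x, f (φ g x) = k g * f x * (k g)⁻¹ := by
    have hg : g ∈ Subgroup.closure S := hS ▸ Subgroup.mem_top g
    induction hg using Subgroup.closure_induction with
    | mem s hs => exact h s hs
    | one => simp
    | mul a b _ _ ha hb =>
      intro x
      rw [map_mul, MulAut.mul_apply, ha, hb, map_mul]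
      group
    | inv a _ ha =>
      intro x
      -- At the point `φ a⁻¹ x` the hypothesis reads `f x = k a * f (φ a⁻¹ x) * (k a)⁻¹`, which is
      -- solved for the middle factor.
      have := ha (φ a⁻¹ x)
      rw [← MulAut.mul_apply, ← map_mul, mul_inv_cancel, map_one, MulAut.one_apply] at this
      rw [this, map_inv k]
      group
  ext x
  simpa using key x

theorem inr_mul_inl_mul_inv (g : Q) (x : N) :
    (inr g * inl x * (inr g)⁻¹ : N ⋊[φ] Q) = inl (φ g x) := by
  rw [inl_aut, map_inv]

/-- If `G` is a retract of `N ⋊ Q` and `N` survives in `G`, then `N` is the kernel of `G → Q`. -/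
theorem injective_and_range_of_retract {A : G →* N ⋊[φ] Q} {B : N ⋊[φ] Q →* G}
    (hBA : B.comp A = MonoidHom.id G) (hAB : (A.comp B).comp inl = inl) :
    Function.Injective (B.comp inl) ∧ (B.comp inl).range = (rightHom.comp A).ker := by
  constructor
  · intro x y hxy
    have := congrArg A hxy
    have e : ∀ z, A (B (inl z)) = inl z := fun z => DFunLike.congr_fun hAB z
    simp only [MonoidHom.comp_apply, e] at this
    exact inl_injective this
  · ext g
    constructor
    · rintro ⟨x, rfl⟩
      have e : A (B (inl x)) = inl x := DFunLike.congr_fun hAB x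
      simp [MonoidHom.mem_ker, e]
    · intro hg
      have hg' : A g ∈ (rightHom : N ⋊[φ] Q →* Q).ker := hg
      rw [← range_inl_eq_ker_rightHom] at hg'
      obtain ⟨x, hx⟩ := hg'
      refine ⟨x, ?_⟩
      rw [MonoidHom.comp_apply, hx]
      exact DFunLike.congr_fun hBA g

/-- An injective homomorphism from a free group gives a free basis of its range. -/
theorem exists_freeGroupBasis {ι : Type*} {j : FreeGroup ι →* G} (hj : Function.Injective j)
    {K : Subgroup G} (hK : j.range = K) :
    ∃ b : FreeGroupBasis ι K, ∀ i, (b i : G) = j (FreeGroup.of i) := by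
  subst hK
  exact ⟨⟨(MonoidHom.ofInjective hj).symm⟩, fun i => rfl⟩

theorem closure_ofAdd_one : Subgroup.closure {Multiplicative.ofAdd (1 : ℤ)} = ⊤ := by
  rw [eq_top_iff]
  intro x _
  rw [Subgroup.mem_closure_singleton]
  exact ⟨x.toAdd, by rw [← ofAdd_zsmul]; simp⟩

/-- A free group on infinitely many generators is not finitely generated. -/
theorem not_fg_of_freeGroupBasis {ι : Type*} [Infinite ι] (b : FreeGroupBasis ι G) :
    ¬ Group.FG G := by
  intro h
  -- Abelianise: finite generation would pass to the free ℤ-module on `ι`, forcing `ι` to be finite.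
  let g : G →* Multiplicative (ι →₀ ℤ) :=
    b.lift fun i => Multiplicative.ofAdd (Finsupp.single i 1)
  have hg : ∀ i, g (b i) = Multiplicative.ofAdd (Finsupp.single i 1) := fun i => by simp [g]
  have hsurj : Function.Surjective g := by
    intro x
    obtain ⟨x, rfl⟩ := Multiplicative.ofAdd.surjective x
    change Multiplicative.ofAdd x ∈ g.range
    induction x using Finsupp.induction_linear with
    | zero => exact one_mem _
    | add x y hx hy => exact mul_mem hx hy
    | single i m =>
      refine ⟨b i ^ m, ?_⟩
      rw [map_zpow, hg, ← ofAdd_zsmul]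
      simp
  have h1 : Group.FG (Multiplicative (ι →₀ ℤ)) := Group.fg_of_surjective hsurj
  have h2 : AddGroup.FG (ι →₀ ℤ) := AddGroup.fg_iff_mul_fg.2 h1
  have h3 : Module.Finite ℤ (ι →₀ ℤ) := Module.Finite.iff_addGroup_fg.2 h2
  exact not_finite_iff_infinite.2 ‹Infinite ι›
    (Module.Finite.finite_basis (Finsupp.basisSingleOne (R := ℤ) (ι := ι)))

end SplitExtensions

/-! ### The exponent-sum-zero subgroup of a free group -/

section ExponentSum

/-- The exponent sum homomorphism. -/
def expSum (ι : Type*) : FreeGroup ι →* Multiplicative ℤ :=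
  FreeGroup.lift fun _ => Multiplicative.ofAdd 1

/-- `ℤ` acts on the free group on `ℤ × κ` by translating the indices. -/
def shiftAct (κ : Type*) : Multiplicative ℤ →* MulAut (FreeGroup (ℤ × κ)) where
  toFun m := FreeGroup.freeGroupCongr ((Equiv.addLeft m.toAdd).prodCongr (Equiv.refl κ))
  map_one' := by
    apply MulEquiv.toMonoidHom_injective
    ext p
    simp
  map_mul' a b := by
    apply MulEquiv.toMonoidHom_injective
    ext ⟨j, k⟩
    simp [add_assoc]

theorem shiftAct_of {κ : Type*} (m j : ℤ) (k : κ) :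
    shiftAct κ (Multiplicative.ofAdd m) (FreeGroup.of (j, k)) = FreeGroup.of (m + j, k) := by
  simp [shiftAct]

variable (n : ℕ)

/-- The homomorphism sending the generator `(j, k)` to `x₀ʲ x_{k+1} x₀^{-(j+1)}`. -/
def sumZeroHom : FreeGroup (ℤ × Fin n) →* FreeGroup (Fin (n + 1)) :=
  FreeGroup.lift fun p =>
    FreeGroup.of 0 ^ p.1 * FreeGroup.of p.2.succ * FreeGroup.of 0 ^ (-(p.1 + 1))

/-- The splitting of the free group over its exponent sum. -/
def toShift : FreeGroup (Fin (n + 1)) →* FreeGroup (ℤ × Fin n) ⋊[shiftAct (Fin n)] Multiplicative ℤ :=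
  -- Here x₀ is the generator of ℤ, and x_{k+1} = (x_{k+1} x₀⁻¹) x₀ with x_{k+1} x₀⁻¹ the generator
  -- of index `(0, k)`.
  FreeGroup.lift (Fin.cases (inr (Multiplicative.ofAdd 1))
    fun k => inl (FreeGroup.of (0, k)) * inr (Multiplicative.ofAdd 1))

/-- The inverse of `toShift`. -/
def ofShift : FreeGroup (ℤ × Fin n) ⋊[shiftAct (Fin n)] Multiplicative ℤ →* FreeGroup (Fin (n + 1)) :=
  SemidirectProduct.lift (sumZeroHom n) (zpowersHom _ (FreeGroup.of 0))
    (comp_act_eq_conj_comp closure_ofAdd_one (by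
      rintro s rfl x
      change ((sumZeroHom n).comp (shiftAct (Fin n) _).toMonoidHom) x =
        ((MulAut.conj _).toMonoidHom.comp (sumZeroHom n)) x
      congr 1
      ext ⟨j, k⟩
      simp only [MonoidHom.comp_apply, MulEquiv.coe_toMonoidHom, MulAut.conj_apply, shiftAct_of,
        sumZeroHom, FreeGroup.lift_apply_of, zpowersHom_apply, toAdd_ofAdd]
      group))

/-- Conjugating x₀ʲ x_{k+1} x₀^{-(j+1)} by x₀ raises j by one, so these elements and x₀ realise the
semidirect product by translation, whose projection to ℤ is the exponent sum. -/
theorem sumZeroHom_spec : Function.Injective (sumZeroHom n) ∧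
    (sumZeroHom n).range = (expSum (Fin (n + 1))).ker := by
  have h := injective_and_range_of_retract (A := toShift n) (B := ofShift n) (by
    ext k
    cases k using Fin.cases <;> simp [toShift, ofShift, sumZeroHom]) (by
    ext1 ⟨j, k⟩
    simp only [MonoidHom.comp_apply, ofShift, lift_inl, sumZeroHom, FreeGroup.lift_apply_of,
      map_mul, map_zpow, toShift, Fin.cases_zero, Fin.cases_succ]
    -- Conjugating the generator `(0, k)` by the j-th power of the acting generator gives `(j, k)`;
    -- the surplus factor in the image of x_{k+1} is absorbed by the exponent -(j+1).
    have e := inr_mul_inl_mul_inv (φ := shiftAct (Fin n)) (Multiplicative.ofAdd (1 : ℤ) ^ j)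
      (FreeGroup.of (0, k))
    have e' : Multiplicative.ofAdd (1 : ℤ) ^ j = Multiplicative.ofAdd j := by
      rw [← ofAdd_zsmul, smul_eq_mul, mul_one]
    rw [map_zpow, e', shiftAct_of, add_zero] at e
    rw [← e]
    group)
  have e1 : (ofShift n).comp inl = sumZeroHom n := lift_comp_inl _ _ _
  have e2 : rightHom.comp (toShift n) = expSum (Fin (n + 1)) := by
    ext k
    cases k using Fin.cases <;> simp [toShift, expSum]
  rwa [e1, e2] at h

/-- The image of the exponent sum kernel is the set of products with exponent sum zero. -/
theorem map_ker_expSum {ι G : Type*} [Group G] (F : ι → G) :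
    ((expSum ι).ker.map (FreeGroup.lift F) : Set G) = exponentSumZero F := by
  have hsum : ∀ w : List (ι × ℤ), expSum ι (w.map fun p => FreeGroup.of p.1 ^ p.2).prod =
      Multiplicative.ofAdd (w.map Prod.snd).sum := by
    intro w
    induction w with
    | nil => rfl
    | cons p w ih =>
      rw [List.map_cons, List.prod_cons, map_mul, ih, List.map_cons, List.sum_cons, ofAdd_add,
        map_zpow, expSum, FreeGroup.lift_apply_of, ← ofAdd_zsmul, smul_eq_mul, mul_one]
  have hlift : ∀ w : List (ι × ℤ), FreeGroup.lift F (w.map fun p => FreeGroup.of p.1 ^ p.2).prod =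
      (w.map fun p => F p.1 ^ p.2).prod := by
    intro w
    simp [map_list_prod, List.map_map, Function.comp_def]
  have hword : ∀ x : FreeGroup ι, ∃ w : List (ι × ℤ),
      x = (w.map fun p => FreeGroup.of p.1 ^ p.2).prod := by
    intro x
    induction x using FreeGroup.induction_on with
    | C1 => exact ⟨[], rfl⟩
    | of i => exact ⟨[(i, 1)], by simp⟩
    | inv_of i _ => exact ⟨[(i, -1)], by simp⟩
    | mul x y hx hy =>
      obtain ⟨v, rfl⟩ := hx
      obtain ⟨w, rfl⟩ := hy
      exact ⟨v ++ w, by simp⟩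
  ext g
  constructor
  · rintro ⟨x, hx, rfl⟩
    obtain ⟨w, rfl⟩ := hword x
    refine ⟨w, ?_, hlift w⟩
    have : expSum ι _ = 1 := hx
    rw [hsum] at this
    exact this
  · rintro ⟨w, hw, rfl⟩
    refine ⟨_, ?_, hlift w⟩
    change expSum ι _ = 1
    rw [hsum, hw]
    rfl

end ExponentSum

/-! ### The Artin action on a free group -/

section Artin

variable {ι : Type*}

theorem mulAut_ext {f g : MulAut (FreeGroup ι)}
    (h : ∀ k, f (FreeGroup.of k) = g (FreeGroup.of k)) : f = g := by
  apply MulEquiv.toMonoidHom_injective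
  ext k
  exact h k

variable [DecidableEq ι]

/-- `x_a ↦ x_b`, `x_b ↦ x_b⁻¹ x_a x_b`, the other generators being fixed. -/
def artinFwd (a b : ι) : FreeGroup ι →* FreeGroup ι :=
  FreeGroup.lift fun k =>
    if k = a then FreeGroup.of b
    else if k = b then (FreeGroup.of b)⁻¹ * FreeGroup.of a * FreeGroup.of b
    else FreeGroup.of k

/-- `x_b ↦ x_a`, `x_a ↦ x_a x_b x_a⁻¹`, the other generators being fixed. -/
def artinBwd (a b : ι) : FreeGroup ι →* FreeGroup ι :=
  FreeGroup.lift fun k =>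
    if k = a then FreeGroup.of a * FreeGroup.of b * (FreeGroup.of a)⁻¹
    else if k = b then FreeGroup.of a
    else FreeGroup.of k

/-- The Artin automorphism attached to two distinct generators. -/
def artinAut {a b : ι} (hab : a ≠ b) : MulAut (FreeGroup ι) :=
  MonoidHom.toMulEquiv (artinFwd a b) (artinBwd a b)
    (by
      ext k
      by_cases h1 : k = a
      · subst h1; simp [artinFwd, artinBwd, hab.symm]
      by_cases h2 : k = b
      · subst h2; simp [artinFwd, artinBwd, h1, mul_assoc]
      · simp [artinFwd, artinBwd, h1, h2])
    (by
      ext k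
      by_cases h1 : k = a
      · subst h1; simp [artinFwd, artinBwd, hab.symm, mul_assoc]
      by_cases h2 : k = b
      · subst h2; simp [artinFwd, artinBwd, h1]
      · simp [artinFwd, artinBwd, h1, h2])

theorem artinAut_apply {a b : ι} (hab : a ≠ b) (x : FreeGroup ι) :
    artinAut hab x = artinFwd a b x := rfl

theorem artinAut_fst {a b : ι} (hab : a ≠ b) :
    artinAut hab (FreeGroup.of a) = FreeGroup.of b := by
  simp [artinAut_apply, artinFwd]

theorem artinAut_snd {a b : ι} (hab : a ≠ b) :
    artinAut hab (FreeGroup.of b) = (FreeGroup.of b)⁻¹ * FreeGroup.of a * FreeGroup.of b := by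
  simp [artinAut_apply, artinFwd, hab.symm]

theorem artinAut_of_ne {a b : ι} (hab : a ≠ b) {k : ι} (ha : k ≠ a) (hb : k ≠ b) :
    artinAut hab (FreeGroup.of k) = FreeGroup.of k := by
  simp [artinAut_apply, artinFwd, ha, hb]

theorem artinAut_comm {a b c d : ι} (hab : a ≠ b) (hcd : c ≠ d) (hac : a ≠ c) (had : a ≠ d)
    (hbc : b ≠ c) (hbd : b ≠ d) :
    artinAut hab * artinAut hcd = artinAut hcd * artinAut hab := by
  have a1 := artinAut_fst hab
  have a2 := artinAut_snd hab
  have a3 := artinAut_of_ne hab hac.symm hbc.symm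
  have a4 := artinAut_of_ne hab had.symm hbd.symm
  have c1 := artinAut_fst hcd
  have c2 := artinAut_snd hcd
  have c3 := artinAut_of_ne hcd hac had
  have c4 := artinAut_of_ne hcd hbc hbd
  apply mulAut_ext
  intro k
  simp only [MulAut.mul_apply]
  by_cases h1 : k = a
  · subst h1; simp only [a1, c3, c4]
  by_cases h2 : k = b
  · subst h2; simp only [a2, c3, c4, map_mul, map_inv]
  by_cases h3 : k = c
  · subst h3; simp only [a3, a4, c1]
  by_cases h4 : k = d
  · subst h4; simp only [a3, a4, c2, map_mul, map_inv]
  · rw [artinAut_of_ne hcd h3 h4, artinAut_of_ne hab h1 h2, artinAut_of_ne hcd h3 h4]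

/-- Both triple products send x_a ↦ x_c, x_b ↦ x_c⁻¹ x_b x_c and x_c ↦ x_c⁻¹ x_b⁻¹ x_a x_b x_c. -/
theorem artinAut_braid {a b c : ι} (hab : a ≠ b) (hbc : b ≠ c) (hac : a ≠ c) :
    Br (artinAut hab) (artinAut hbc) := by
  have a1 := artinAut_fst hab
  have a2 := artinAut_snd hab
  have a3 := artinAut_of_ne hab hac.symm hbc.symm
  have c1 := artinAut_fst hbc
  have c2 := artinAut_snd hbc
  have c3 := artinAut_of_ne hbc hab hac
  apply mulAut_ext
  intro k
  simp only [MulAut.mul_apply]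
  by_cases h1 : k = a
  · subst h1; simp only [a1, a3, c1, c3]
  by_cases h2 : k = b
  · subst h2
    simp only [a1, a2, a3, c1, c2, c3, map_mul, map_inv]
  by_cases h3 : k = c
  · subst h3
    simp only [a2, a3, c1, c2, c3, map_mul, map_inv]
    group
  · have e1 := artinAut_of_ne hab h1 h2
    have e2 := artinAut_of_ne hbc h2 h3
    simp only [e1, e2]

end Artin

/-- The Artin action of the braid group on the free group on `x₀, …, xₙ`. -/
def artinHom (n : ℕ) : BraidA n →* MulAut (FreeGroup (Fin (n + 1))) :=
  PresentedGroup.toGroup (rels := {r | ARel n r})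
    (f := fun i : Fin n => artinAut (Fin.castSucc_lt_succ (i := i)).ne) (by
      intro r hr
      cases hr with
      | comm i j h =>
        rw [map_commRel, commRel_eq_one]
        simp only [FreeGroup.lift_apply_of]
        apply artinAut_comm <;>
          simp only [ne_eq, Fin.ext_iff, Fin.val_castSucc, Fin.val_succ] <;> omega
      | braid i j h =>
        rw [map_braidRel, braidRel_eq_one]
        simp only [FreeGroup.lift_apply_of]
        have e : j.castSucc = i.succ := by
          simp only [Fin.ext_iff, Fin.val_castSucc, Fin.val_succ]; omega
        have := artinAut_braid (a := i.castSucc) (b := i.succ) (c := j.succ)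
          (Fin.castSucc_lt_succ).ne
          (by simp only [ne_eq, Fin.ext_iff, Fin.val_succ]; omega)
          (by simp only [ne_eq, Fin.ext_iff, Fin.val_castSucc, Fin.val_succ]; omega)
        simpa only [e] using this)

theorem artinHom_sigma {n : ℕ} (i : Fin n) :
    artinHom n (sigmaA i) = artinAut (Fin.castSucc_lt_succ (i := i)).ne :=
  PresentedGroup.toGroup.of _

/-! ### Conjugation of the elements `F_k` by the `σ_i` -/

section FElt

variable {n : ℕ}

theorem FElt_zero : FElt n 0 = tB n := rfl

theorem FElt_succ (i : Fin n) :
    FElt n i.succ = sigmaB i * FElt n i.castSucc * (sigmaB i)⁻¹ := rfl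

theorem conj_conj {G : Type*} [Group G] (g h x : G) :
    g * (h * x * h⁻¹) * g⁻¹ = (g * h) * x * (g * h)⁻¹ := by group

/-- `F_k` is a word in t and σ₁, …, σ_k only, all of which commute with σ_{i+1} when k < i. -/
theorem sigmaB_conj_FElt_lt (i : Fin n) (k : Fin (n + 1)) (h : k.val < i.val) :
    sigmaB i * FElt n k * (sigmaB i)⁻¹ = FElt n k := by
  induction k using Fin.induction with
  | zero =>
    rw [FElt_zero, sigmaB_comm_t n i (by omega)]
    group
  | succ k ih =>
    simp only [Fin.val_succ, Fin.val_castSucc] at h ih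
    have ih := ih (by omega)
    rw [FElt_succ, conj_conj, ← (braidFam_sigmaB n).comm k i (by omega), ← conj_conj, ih]

/-- For k = i + 2, `F_k` is the conjugate of `F_i` by σ_{i+2}σ_{i+1}; the braid relation moves
σ_{i+1} past this word, turning it into σ_{i+2}, which fixes `F_i`. For larger k the outer letter
commutes with σ_{i+1}. -/
theorem sigmaB_conj_FElt_gt (i : Fin n) (k : Fin (n + 1)) (h : i.val + 1 < k.val) :
    sigmaB i * FElt n k * (sigmaB i)⁻¹ = FElt n k := by
  induction k using Fin.induction with
  | zero => simp at h
  | succ k ih =>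
    simp only [Fin.val_succ, Fin.val_castSucc] at h ih
    rcases (show i.val + 1 ≤ k.val by omega).eq_or_lt with hk | hk
    · have e : k.castSucc = i.succ := by
        simp only [Fin.ext_iff, Fin.val_castSucc, Fin.val_succ]; omega
      have hb : Br (sigmaB i) (sigmaB k) := (braidFam_sigmaB n).braid i k hk
      have h1 := sigmaB_conj_FElt_lt k i.castSucc (by simp only [Fin.val_castSucc]; omega)
      rw [FElt_succ, e, FElt_succ, conj_conj, conj_conj, ← mul_assoc, hb,
        ← conj_conj _ (sigmaB k), h1]
      group
    · rw [FElt_succ, conj_conj, (braidFam_sigmaB n).comm i k hk, ← conj_conj, ih hk]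

/-- For i = 0 this is the braid relation of length four. Conjugation by σ_{i+1}σ_{i+2} takes
σ_{i+1}, `F_i`, `F_{i+1}` to σ_{i+2}, `F_{i+1}`, `F_{i+2}`, hence carries each case to the next. -/
theorem sigmaB_conj_FElt_succ (i : Fin n) :
    sigmaB i * FElt n i.succ * (sigmaB i)⁻¹ =
      (FElt n i.succ)⁻¹ * FElt n i.castSucc * FElt n i.succ := by
  obtain ⟨m, hm⟩ := i
  induction m with
  | zero =>
    have : NeZero n := ⟨by omega⟩
    have h := sigmaB_braid_t n
    change sigmaB 0 * (sigmaB 0 * tB n * (sigmaB 0)⁻¹) * (sigmaB 0)⁻¹ =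
      (sigmaB 0 * tB n * (sigmaB 0)⁻¹)⁻¹ * tB n * (sigmaB 0 * tB n * (sigmaB 0)⁻¹)
    generalize (sigmaB 0 : BraidB n) = s at *
    generalize tB n = t at *
    have h2 : s * t * s * t * (s * s)⁻¹ = t * s * t * s * (s * s)⁻¹ := by rw [h]
    calc _ = (s * t * s⁻¹)⁻¹ * (s * t * s * t * (s * s)⁻¹) := by group
      _ = _ := by rw [h2]; group
  | succ m ih =>
    have ih := ih (by omega)
    set i : Fin n := ⟨m, by omega⟩
    set j : Fin n := ⟨m + 1, hm⟩
    have hb : Br (sigmaB i) (sigmaB j) := (braidFam_sigmaB n).braid i j rfl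
    have e : j.castSucc = i.succ := rfl
    have h1 := sigmaB_conj_FElt_lt j i.castSucc (Nat.lt_succ_self m)
    have h2 := sigmaB_conj_FElt_gt i j.succ (Nat.lt_succ_self (m + 1))
    have e1 : (sigmaB i * sigmaB j) * FElt n i.castSucc * (sigmaB i * sigmaB j)⁻¹ =
        FElt n j.castSucc := by rw [← conj_conj, h1, e, FElt_succ]
    have e2 : (sigmaB i * sigmaB j) * FElt n i.succ * (sigmaB i * sigmaB j)⁻¹ =
        FElt n j.succ := by rw [← conj_conj, ← e, ← FElt_succ, h2]
    have e3 : (sigmaB i * sigmaB j) * sigmaB i * (sigmaB i * sigmaB j)⁻¹ = sigmaB j := by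
      rw [hb]; group
    have h3 := congrArg (MulAut.conj (sigmaB i * sigmaB j)) ih
    generalize hg : sigmaB i * sigmaB j = g at e1 e2 e3 h3
    simpa only [map_mul, map_inv, MulAut.conj_apply, e1, e2, e3] using h3

end FElt

/-! ### `B(B_{n+1})` as a semidirect product of a free group and `B(Aₙ)` -/

section Alpha

variable (n : ℕ)

/-- The section `B(Aₙ) → B(B_{n+1})` of `α`. -/
def sectionHom : BraidA n →* BraidB n :=
  PresentedGroup.toGroup (rels := {r | ARel n r}) (f := sigmaB) (by
    intro r hr
    cases hr with
    | comm i j h =>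
      rw [map_commRel, commRel_eq_one]; simpa using (braidFam_sigmaB n).comm i j h
    | braid i j h =>
      rw [map_braidRel, braidRel_eq_one]; simpa using (braidFam_sigmaB n).braid i j h)

theorem sectionHom_sigma (i : Fin n) : sectionHom n (sigmaA i) = sigmaB i :=
  PresentedGroup.toGroup.of _

/-- The homomorphism from the free group to `B(B_{n+1})` with `x_k ↦ F_k`. -/
def freeHom : FreeGroup (Fin (n + 1)) →* BraidB n := FreeGroup.lift (FElt n)

/-- The three conjugation rules for the `F_k` are the values of the Artin automorphism on
generators; this equivariance is what `ofArtin` needs. -/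
theorem freeHom_artin (i : Fin n) (x : FreeGroup (Fin (n + 1))) :
    freeHom n (artinHom n (sigmaA i) x) =
      sectionHom n (sigmaA i) * freeHom n x * (sectionHom n (sigmaA i))⁻¹ := by
  rw [sectionHom_sigma, artinHom_sigma]
  set A := artinAut (Fin.castSucc_lt_succ (i := i)).ne with hA
  change ((freeHom n).comp A.toMonoidHom) x =
    ((MulAut.conj (sigmaB i)).toMonoidHom.comp (freeHom n)) x
  congr 1
  ext k
  simp only [MonoidHom.comp_apply, MulEquiv.coe_toMonoidHom, MulAut.conj_apply]
  by_cases h1 : k = i.castSucc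
  · subst h1
    rw [hA, artinAut_fst]
    simp only [freeHom, FreeGroup.lift_apply_of, FElt_succ]
  by_cases h2 : k = i.succ
  · subst h2
    rw [hA, artinAut_snd]
    simp only [freeHom, map_mul, map_inv, FreeGroup.lift_apply_of, sigmaB_conj_FElt_succ]
  · rw [hA, artinAut_of_ne _ h1 h2]
    simp only [freeHom, FreeGroup.lift_apply_of]
    simp only [Fin.ext_iff, Fin.val_castSucc, Fin.val_succ] at h1 h2
    rcases lt_or_gt_of_ne h1 with h | h
    · rw [sigmaB_conj_FElt_lt i k h]
    · rw [sigmaB_conj_FElt_gt i k (by omega)]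

/-- Images of the generators of `B(B_{n+1})` in the semidirect product. -/
def artinGen : BGen n → FreeGroup (Fin (n + 1)) ⋊[artinHom n] BraidA n
  | BGen.sigma i => inr (sigmaA i)
  | BGen.t => inl (FreeGroup.of 0)

/-- The Artin automorphisms of σ₂, …, σₙ fix x₀, so these commute with t; the length-four relation
encodes the value of the automorphism of σ₁ on x₁. -/
theorem artinGen_rel : ∀ r ∈ {r | BRel n r}, FreeGroup.lift (artinGen n) r = 1 := by
  have hA := braidFam_sigmaA n
  intro r hr
  cases hr with
  | comm i j h =>
    rw [map_commRel, commRel_eq_one]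
    simp only [FreeGroup.lift_apply_of, artinGen, ← map_mul, hA.comm i j h]
  | braid i j h =>
    rw [map_braidRel, braidRel_eq_one]
    have : sigmaA i * sigmaA j * sigmaA i = sigmaA j * sigmaA i * sigmaA j := hA.braid i j h
    simp only [FreeGroup.lift_apply_of, artinGen, Br, ← map_mul, this]
  | comm_t i h =>
    rw [map_commRel, commRel_eq_one]
    simp only [FreeGroup.lift_apply_of, artinGen]
    rw [← mul_inv_eq_iff_eq_mul, inr_mul_inl_mul_inv, artinHom_sigma, artinAut_of_ne]
    · simp only [ne_eq, Fin.ext_iff, Fin.val_castSucc, Fin.val_zero]; omega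
    · simp only [ne_eq, Fin.ext_iff, Fin.val_succ, Fin.val_zero]; omega
  | braid_t i h =>
    rw [map_braidRel4, braidRel4_eq_one]
    simp only [FreeGroup.lift_apply_of, artinGen]
    have e0 : (0 : Fin (n + 1)) = i.castSucc := Fin.ext (by simp [h])
    have h1 := inr_mul_inl_mul_inv (φ := artinHom n) (sigmaA i) (FreeGroup.of i.castSucc)
    have h2 := inr_mul_inl_mul_inv (φ := artinHom n) (sigmaA i) (FreeGroup.of i.succ)
    rw [artinHom_sigma, artinAut_fst] at h1
    rw [artinHom_sigma, artinAut_snd, map_mul, map_mul, map_inv, ← h1] at h2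
    rw [e0]
    generalize (inr (sigmaA i) : FreeGroup (Fin (n + 1)) ⋊[artinHom n] BraidA n) = s at *
    generalize (inl (FreeGroup.of i.castSucc) :
      FreeGroup (Fin (n + 1)) ⋊[artinHom n] BraidA n) = t at *
    -- With y = s t s⁻¹, `h2` says s y s⁻¹ = y⁻¹ t y, so s t s t = y (s y s⁻¹) s² = t y s² = t s t
    -- s.
    calc _ = s * t * s⁻¹ * (s * (s * t * s⁻¹) * s⁻¹) * s * s := by group
      _ = _ := by rw [h2]; group

/-- The map from `B(B_{n+1})` to the semidirect product. -/
def toArtin : BraidB n →* FreeGroup (Fin (n + 1)) ⋊[artinHom n] BraidA n :=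
  PresentedGroup.toGroup (artinGen_rel n)

theorem toArtin_sigma (i : Fin n) : toArtin n (sigmaB i) = inr (sigmaA i) :=
  PresentedGroup.toGroup.of _

theorem toArtin_t : toArtin n (tB n) = inl (FreeGroup.of 0) :=
  PresentedGroup.toGroup.of _

/-- The map from the semidirect product to `B(B_{n+1})`. -/
def ofArtin : FreeGroup (Fin (n + 1)) ⋊[artinHom n] BraidA n →* BraidB n :=
  SemidirectProduct.lift (freeHom n) (sectionHom n)
    (comp_act_eq_conj_comp (PresentedGroup.closure_range_of _) (by
      rintro _ ⟨i, rfl⟩ x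
      exact freeHom_artin n i x))

theorem toArtin_FElt (k : Fin (n + 1)) : toArtin n (FElt n k) = inl (FreeGroup.of k) := by
  induction k using Fin.induction with
  | zero => exact toArtin_t n
  | succ k ih =>
    rw [FElt_succ, map_mul, map_mul, map_inv, ih, toArtin_sigma, inr_mul_inl_mul_inv,
      artinHom_sigma, artinAut_fst]

theorem alphaHom_sigma (i : Fin n) : alphaHom n (sigmaB i) = sigmaA i :=
  PresentedGroup.toGroup.of _

theorem alphaHom_t : alphaHom n (tB n) = 1 := PresentedGroup.toGroup.of _

theorem BraidB.hom_ext {n : ℕ} {G : Type*} [Group G] {f g : BraidB n →* G}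
    (hs : ∀ i, f (sigmaB i) = g (sigmaB i)) (ht : f (tB n) = g (tB n)) : f = g :=
  PresentedGroup.ext fun x => match x with
    | BGen.sigma i => hs i
    | BGen.t => ht

/-- `toArtin` recovers x_k from `F_k`, so no relation among the `F_k` can hold; the projection of
the semidirect product pulls back to α. -/
theorem freeHom_spec :
    Function.Injective (freeHom n) ∧ (freeHom n).range = (alphaHom n).ker := by
  have e1 : (ofArtin n).comp inl = freeHom n := lift_comp_inl _ _ _
  have e2 : rightHom.comp (toArtin n) = alphaHom n := by
    apply BraidB.hom_ext
    · intro i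
      rw [MonoidHom.comp_apply, toArtin_sigma, rightHom_inr, alphaHom_sigma]
    · rw [MonoidHom.comp_apply, toArtin_t, rightHom_inl, alphaHom_t]
  have h := injective_and_range_of_retract (A := toArtin n) (B := ofArtin n)
    (by
      apply BraidB.hom_ext
      · intro i
        rw [MonoidHom.comp_apply, toArtin_sigma, ofArtin, lift_inr, sectionHom_sigma,
          MonoidHom.id_apply]
      · rw [MonoidHom.comp_apply, toArtin_t, ofArtin, lift_inl, freeHom, FreeGroup.lift_apply_of,
          MonoidHom.id_apply, FElt_zero])
    (by
      rw [MonoidHom.comp_assoc, e1]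
      ext1 k
      rw [MonoidHom.comp_apply, freeHom, FreeGroup.lift_apply_of, toArtin_FElt])
  rwa [e1, e2] at h

end Alpha

/-! ### `B(B_{n+1})` as a semidirect product of `B(Ãₙ)` and `ℤ` -/

section Relations

variable {n : ℕ}

theorem braidFam_sigmaAff (n : ℕ) : BraidFam (sigmaAff : Fin n → BraidAff n) where
  comm i j h := by
    have := PresentedGroup.one_of_mem (rels := {r | AffRel n r}) (AffRel.comm i j h)
    rw [map_commRel] at this
    exact commRel_eq_one.1 this
  braid i j h := by
    have := PresentedGroup.one_of_mem (rels := {r | AffRel n r}) (AffRel.braid i j h)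
    rw [map_braidRel] at this
    exact braidRel_eq_one.1 this

theorem sigmaAff_comm_a (i : Fin n) (h₁ : 1 ≤ i.val) (h₂ : i.val + 2 ≤ n) :
    sigmaAff i * aAff n = aAff n * sigmaAff i := by
  have := PresentedGroup.one_of_mem (rels := {r | AffRel n r}) (AffRel.comm_a i h₁ h₂)
  rw [map_commRel] at this
  exact commRel_eq_one.1 this

theorem sigmaAff_braid_first (i : Fin n) (hn : 2 ≤ n) (h : i.val = 0) :
    Br (sigmaAff i) (aAff n) := by
  have := PresentedGroup.one_of_mem (rels := {r | AffRel n r}) (AffRel.braid_first i hn h)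
  rw [map_braidRel] at this
  exact braidRel_eq_one.1 this

theorem sigmaAff_braid_last (i : Fin n) (hn : 2 ≤ n) (h : i.val + 1 = n) :
    Br (sigmaAff i) (aAff n) := by
  have := PresentedGroup.one_of_mem (rels := {r | AffRel n r}) (AffRel.braid_last i hn h)
  rw [map_braidRel] at this
  exact braidRel_eq_one.1 this

theorem BraidAff.hom_ext {G : Type*} [Group G] {f g : BraidAff n →* G}
    (hs : ∀ i, f (sigmaAff i) = g (sigmaAff i)) (ha : f (aAff n) = g (aAff n)) : f = g :=
  PresentedGroup.ext fun x => match x with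
    | AffGen.sigma i => hs i
    | AffGen.a => ha

end Relations

/-! ### The cyclic symmetry of the affine diagram -/

section Rotation

variable (n : ℕ) [NeZero n]

/-- Rotation of the generators: `σ₁ ↦ σ₂ ↦ ⋯ ↦ σₙ ↦ a_{n+1} ↦ σ₁`. -/
def rotGen : AffGen n → BraidAff n
  | AffGen.sigma i => if h : i.val + 1 < n then sigmaAff ⟨i.val + 1, h⟩ else aAff n
  | AffGen.a => sigmaAff 0

/-- The inverse rotation of the generators. -/
def rotInvGen : AffGen n → BraidAff n
  | AffGen.sigma i => if i.val = 0 then aAff n else sigmaAff ⟨i.val - 1, by omega⟩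
  | AffGen.a => sigmaAff (lastIdx n)

/-- The affine diagram is a cycle, and rotation preserves its edges and non-edges; for n = 1 there
are no relators. The cases record where an index runs past σₙ to a_{n+1}, or returns to σ₁, where
the relation appears reversed. -/
theorem rotGen_rel : ∀ r ∈ {r | AffRel n r}, FreeGroup.lift (rotGen n) r = 1 := by
  have hA := braidFam_sigmaAff n
  intro r hr
  cases hr with
  | comm i j h =>
    rw [map_commRel, commRel_eq_one]
    simp only [FreeGroup.lift_apply_of, rotGen]
    rw [dif_pos (show i.val + 1 < n by omega)]
    split_ifs with hj
    · exact hA.comm _ _ (by simp only; omega)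
    · exact sigmaAff_comm_a _ (by simp only; omega) (by simp only; omega)
  | braid i j h =>
    rw [map_braidRel, braidRel_eq_one]
    simp only [FreeGroup.lift_apply_of, rotGen]
    rw [dif_pos (show i.val + 1 < n by omega)]
    split_ifs with hj
    · exact hA.braid _ _ (by simp only; omega)
    · exact sigmaAff_braid_last _ (by omega) (by simp only; omega)
  | comm_a i h₁ h₂ =>
    rw [map_commRel, commRel_eq_one]
    simp only [FreeGroup.lift_apply_of, rotGen]
    rw [dif_pos (show i.val + 1 < n by omega)]
    exact (hA.comm _ _ (by simp only [Fin.val_zero]; omega)).symm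
  | braid_first i hn h =>
    rw [map_braidRel, braidRel_eq_one]
    simp only [FreeGroup.lift_apply_of, rotGen]
    rw [dif_pos (show i.val + 1 < n by omega)]
    exact (hA.braid _ _ (by simp only [Fin.val_zero]; omega)).symm
  | braid_last i hn h =>
    rw [map_braidRel, braidRel_eq_one]
    simp only [FreeGroup.lift_apply_of, rotGen]
    rw [dif_neg (show ¬ i.val + 1 < n by omega)]
    exact (sigmaAff_braid_first 0 hn (by simp)).symm

theorem rotInvGen_rel : ∀ r ∈ {r | AffRel n r}, FreeGroup.lift (rotInvGen n) r = 1 := by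
  have hA := braidFam_sigmaAff n
  intro r hr
  cases hr with
  | comm i j h =>
    rw [map_commRel, commRel_eq_one]
    simp only [FreeGroup.lift_apply_of, rotInvGen]
    rw [if_neg (show ¬ j.val = 0 by omega)]
    split_ifs with hi
    · exact (sigmaAff_comm_a _ (by simp only; omega) (by simp only; omega)).symm
    · exact hA.comm _ _ (by simp only; omega)
  | braid i j h =>
    rw [map_braidRel, braidRel_eq_one]
    simp only [FreeGroup.lift_apply_of, rotInvGen]
    rw [if_neg (show ¬ j.val = 0 by omega)]
    split_ifs with hi
    · exact (sigmaAff_braid_first _ (by omega) (by simp only; omega)).symm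
    · exact hA.braid _ _ (by simp only; omega)
  | comm_a i h₁ h₂ =>
    rw [map_commRel, commRel_eq_one]
    simp only [FreeGroup.lift_apply_of, rotInvGen]
    rw [if_neg (show ¬ i.val = 0 by omega)]
    exact hA.comm _ _ (by simp only [lastIdx]; omega)
  | braid_first i hn h =>
    rw [map_braidRel, braidRel_eq_one]
    simp only [FreeGroup.lift_apply_of, rotInvGen]
    rw [if_pos h]
    exact (sigmaAff_braid_last _ hn (by simp only [lastIdx]; omega)).symm
  | braid_last i hn h =>
    rw [map_braidRel, braidRel_eq_one]
    simp only [FreeGroup.lift_apply_of, rotInvGen]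
    rw [if_neg (show ¬ i.val = 0 by omega)]
    exact hA.braid _ _ (by simp only [lastIdx]; omega)

/-- The rotation as an endomorphism of `B(Ãₙ)`. -/
def rotFwd : BraidAff n →* BraidAff n := PresentedGroup.toGroup (rotGen_rel n)

/-- The inverse rotation as an endomorphism of `B(Ãₙ)`. -/
def rotBwd : BraidAff n →* BraidAff n := PresentedGroup.toGroup (rotInvGen_rel n)

theorem rotFwd_sigma {i j : Fin n} (h : i.val + 1 = j.val) :
    rotFwd n (sigmaAff i) = sigmaAff j := by
  refine (PresentedGroup.toGroup.of _).trans ?_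
  rw [rotGen, dif_pos (show i.val + 1 < n by omega)]
  congr 1
  exact Fin.ext h

theorem rotFwd_last {i : Fin n} (h : i.val + 1 = n) : rotFwd n (sigmaAff i) = aAff n := by
  refine (PresentedGroup.toGroup.of _).trans ?_
  rw [rotGen, dif_neg (by omega)]

theorem rotFwd_a : rotFwd n (aAff n) = sigmaAff 0 := PresentedGroup.toGroup.of _

theorem rotBwd_sigma {i j : Fin n} (h : i.val + 1 = j.val) :
    rotBwd n (sigmaAff j) = sigmaAff i := by
  refine (PresentedGroup.toGroup.of _).trans ?_
  rw [rotInvGen, if_neg (by omega)]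
  congr 1
  exact Fin.ext (by simp only; omega)

theorem rotBwd_zero : rotBwd n (sigmaAff 0) = aAff n := by
  refine (PresentedGroup.toGroup.of _).trans ?_
  rw [rotInvGen, if_pos (by simp)]

theorem rotBwd_a : rotBwd n (aAff n) = sigmaAff (lastIdx n) := PresentedGroup.toGroup.of _

/-- The rotation automorphism of `B(Ãₙ)`. -/
def rotAut : MulAut (BraidAff n) :=
  MonoidHom.toMulEquiv (rotFwd n) (rotBwd n)
    (by
      apply BraidAff.hom_ext
      · intro i
        rw [MonoidHom.comp_apply, MonoidHom.id_apply]
        by_cases h : i.val + 1 < n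
        · rw [rotFwd_sigma n (j := ⟨i.val + 1, h⟩) rfl, rotBwd_sigma n rfl]
        · rw [rotFwd_last n (by omega), rotBwd_a]
          congr 1
          exact Fin.ext (by simp only [lastIdx]; omega)
      · rw [MonoidHom.comp_apply, MonoidHom.id_apply, rotFwd_a, rotBwd_zero])
    (by
      apply BraidAff.hom_ext
      · intro i
        rw [MonoidHom.comp_apply, MonoidHom.id_apply]
        by_cases h : i.val = 0
        · obtain rfl : i = 0 := Fin.ext (by simpa using h)
          rw [rotBwd_zero, rotFwd_a]
        · have e : (⟨i.val - 1, by omega⟩ : Fin n).val + 1 = i.val := by simp only; omega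
          rw [rotBwd_sigma n e, rotFwd_sigma n e]
      · rw [MonoidHom.comp_apply, MonoidHom.id_apply, rotBwd_a,
          rotFwd_last n (by simp only [lastIdx]; have := NeZero.ne n; omega)])

theorem rotAut_apply (x : BraidAff n) : rotAut n x = rotFwd n x := rfl

/-- The action of `ℤ` on `B(Ãₙ)` by rotation. -/
def rotAct : Multiplicative ℤ →* MulAut (BraidAff n) := zpowersHom _ (rotAut n)

theorem rotAct_one : rotAct n (Multiplicative.ofAdd 1) = rotAut n := by
  simp [rotAct]

end Rotation

/-! ### Type B relations recovered from the cyclic shift -/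

section Rotating

variable {G : Type*} [Group G] {n : ℕ}

theorem map_ascProd {H : Type*} [Group H] (f : G →* H) (s : Fin n → G) :
    f (ascProd s) = ascProd fun i => f (s i) := by
  simp [ascProd, map_list_prod, List.map_ofFn, Function.comp_def]

theorem map_bWord [NeZero n] {H : Type*} [Group H] (f : G →* H) (s : Fin n → G) :
    f (bWord s) = bWord fun i => f (s i) := by
  simp [bWord, map_ascProd]

/-- If conjugation by `t s₁ ⋯ sₙ` shifts the family, then `t` commutes with `s₂, …, sₙ`. -/
theorem comm_of_phi_shift {s : Fin n → G} (h : BraidFam s) {t : G} {i j : Fin n}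
    (hij : i.val + 1 = j.val)
    (hs : (t * ascProd s) * s i * (t * ascProd s)⁻¹ = s j) : s j * t = t * s j := by
  have h1 := ascProd_shift s h i j hij
  set P := ascProd s
  calc s j * t = t * (P * s i) * P⁻¹ := by rw [← hs]; group
    _ = _ := by rw [h1]; group

/-- If conjugation by the square of `t s₁ ⋯ sₙ` takes `sₙ` to `s₁`, and `t` commutes with
`s₂, …, sₙ`, then `s₁` and `t` satisfy the braid relation of length four. -/
theorem braid4_of_phi_shift [NeZero n] {s : Fin n → G} (h : BraidFam s) {t : G}
    (ht : ∀ i : Fin n, 1 ≤ i.val → s i * t = t * s i)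
    (hl : (t * ascProd s) * ((t * ascProd s) * s (lastIdx n) * (t * ascProd s)⁻¹) *
      (t * ascProd s)⁻¹ = s 0) :
    s 0 * t * s 0 * t = t * s 0 * t * s 0 := by
  have h1 := bWord_eq s h
  -- All factors after s₁ commute with t, so only s₁ contributes to the conjugation.
  have h2 : ascProd s * t * (ascProd s)⁻¹ = s 0 * t * (s 0)⁻¹ := by
    obtain ⟨m, rfl⟩ := Nat.exists_eq_succ_of_ne_zero (NeZero.ne n)
    have h3 : ascProd s = s 0 * ascProd (fun i : Fin m => s i.succ) := by
      simp [ascProd, List.ofFn_succ]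
    have h4 := ascProd_commute (fun i : Fin m => s i.succ) t
      (fun i => (ht i.succ (by simp)).symm)
    rw [h3]
    set w := ascProd (fun i : Fin m => s i.succ)
    calc _ = s 0 * (w * t) * w⁻¹ * (s 0)⁻¹ := by group
      _ = _ := by rw [← h4]; group
  have h5 : ascProd s * bWord s * (ascProd s)⁻¹ = s 0 := by simp only [bWord]; group
  set P := ascProd s
  set x := s 0
  -- With φ = tP, φ² = t (P t P⁻¹) P², and P² sₙ P⁻² = s₁ by `h1` and `h5`. So x is its own
  -- conjugate by t x t x⁻¹.
  have h6 : x = (t * x * t * x) * (t * x * t)⁻¹ := by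
    calc x = t * (P * t * P⁻¹) * (P * (P * s (lastIdx n) * P⁻¹) * P⁻¹) *
          (P * t * P⁻¹)⁻¹ * t⁻¹ := by rw [← hl]; group
      _ = _ := by rw [h1, h2, h5]; group
  calc x * t * x * t = x * (t * x * t) := by group
    _ = (t * x * t * x) * (t * x * t)⁻¹ * (t * x * t) := by rw [← h6]
    _ = _ := by group

end Rotating

/-! ### Injectivity of i and its image -/

section Affine

variable (n : ℕ) [NeZero n]

/-- Images of the generators of `B(B_{n+1})` in `B(Ãₙ) ⋊ ℤ`. -/
def affGen : BGen n → BraidAff n ⋊[rotAct n] Multiplicative ℤ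
  | BGen.sigma i => inl (sigmaAff i)
  -- Chosen so that φ = tσ₁⋯σₙ maps to the generator of ℤ.
  | BGen.t => inr (Multiplicative.ofAdd 1) * (inl (ascProd sigmaAff))⁻¹

/-- Conjugation by the image of φ is the rotation by construction, and the shift property alone
forces the relations involving t. -/
theorem affGen_rel : ∀ r ∈ {r | BRel n r}, FreeGroup.lift (affGen n) r = 1 := by
  have hA := braidFam_sigmaAff n
  let s : Fin n → BraidAff n ⋊[rotAct n] Multiplicative ℤ := fun i => inl (sigmaAff i)
  have hS : BraidFam s := by
    constructor
    · intro i j h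
      simp only [s, ← map_mul, hA.comm i j h]
    · intro i j h
      have : sigmaAff i * sigmaAff j * sigmaAff i = sigmaAff j * sigmaAff i * sigmaAff j :=
        hA.braid i j h
      simp only [s, Br, ← map_mul, this]
  set t : BraidAff n ⋊[rotAct n] Multiplicative ℤ :=
    inr (Multiplicative.ofAdd 1) * (inl (ascProd sigmaAff))⁻¹ with ht
  have hphi : t * ascProd s = inr (Multiplicative.ofAdd 1) := by
    rw [ht, map_ascProd, inv_mul_cancel_right]
  have hconj : ∀ x : BraidAff n, (t * ascProd s) * inl x * (t * ascProd s)⁻¹ =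
      inl (rotFwd n x) := by
    intro x
    rw [hphi, inr_mul_inl_mul_inv, rotAct_one, rotAut_apply]
  have hcomm : ∀ i : Fin n, 1 ≤ i.val → s i * t = t * s i := by
    intro j hj
    have e : (⟨j.val - 1, by omega⟩ : Fin n).val + 1 = j.val := by simp only; omega
    apply comm_of_phi_shift hS e
    rw [hconj, rotFwd_sigma n e]
  have hbraid : s 0 * t * s 0 * t = t * s 0 * t * s 0 := by
    apply braid4_of_phi_shift hS hcomm
    rw [hconj, hconj, rotFwd_last n (by simp only [lastIdx]; have := NeZero.ne n; omega), rotFwd_a]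
  intro r hr
  cases hr with
  | comm i j h =>
    rw [map_commRel, commRel_eq_one]; simp only [FreeGroup.lift_apply_of]; exact hS.comm i j h
  | braid i j h =>
    rw [map_braidRel, braidRel_eq_one]; simp only [FreeGroup.lift_apply_of]; exact hS.braid i j h
  | comm_t i h =>
    rw [map_commRel, commRel_eq_one]; simp only [FreeGroup.lift_apply_of]; exact hcomm i h
  | braid_t i h =>
    obtain rfl : i = 0 := Fin.ext (by simpa using h)
    rw [map_braidRel4, braidRel4_eq_one]; simp only [FreeGroup.lift_apply_of]; exact hbraid

/-- The map from `B(B_{n+1})` to `B(Ãₙ) ⋊ ℤ`. -/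
def toAff : BraidB n →* BraidAff n ⋊[rotAct n] Multiplicative ℤ :=
  PresentedGroup.toGroup (affGen_rel n)

theorem toAff_sigma (i : Fin n) : toAff n (sigmaB i) = inl (sigmaAff i) :=
  PresentedGroup.toGroup.of _

theorem toAff_t : toAff n (tB n) =
    inr (Multiplicative.ofAdd 1) * (inl (ascProd sigmaAff))⁻¹ :=
  PresentedGroup.toGroup.of _

theorem toAff_phi : toAff n (phiB n) = inr (Multiplicative.ofAdd 1) := by
  simp only [phiB, map_mul, toAff_t, map_ascProd, toAff_sigma]
  exact inv_mul_cancel_right _ _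

theorem iHom_sigma (i : Fin n) : iHom n (sigmaAff i) = sigmaB i := PresentedGroup.toGroup.of _

theorem iHom_a : iHom n (aAff n) = phiB n * sigmaB (lastIdx n) * (phiB n)⁻¹ :=
  PresentedGroup.toGroup.of _

/-- Rotation becomes conjugation by φ: σₙ ↦ a_{n+1} is the definition of i, the remaining generators
are `phi_shift` and `phi_shift_last`. -/
theorem iHom_rotFwd (x : BraidAff n) :
    iHom n (rotFwd n x) = phiB n * iHom n x * (phiB n)⁻¹ := by
  have hs := phi_shift _ (braidFam_sigmaB n) (tB n) (sigmaB_comm_t n)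
  have hl := phi_shift_last _ (braidFam_sigmaB n) (tB n) (sigmaB_comm_t n) (sigmaB_braid_t n)
  change ((iHom n).comp (rotFwd n)) x = ((MulAut.conj (phiB n)).toMonoidHom.comp (iHom n)) x
  congr 1
  apply BraidAff.hom_ext
  · intro i
    simp only [MonoidHom.comp_apply, MulEquiv.coe_toMonoidHom, MulAut.conj_apply]
    by_cases h : i.val + 1 < n
    · rw [rotFwd_sigma n (j := ⟨i.val + 1, h⟩) rfl, iHom_sigma, iHom_sigma]
      exact (hs i ⟨i.val + 1, h⟩ rfl).symm
    · obtain rfl : i = lastIdx n := Fin.ext (by simp only [lastIdx]; omega)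
      rw [rotFwd_last n (by omega), iHom_a, iHom_sigma]
  · simp only [MonoidHom.comp_apply, MulEquiv.coe_toMonoidHom, MulAut.conj_apply]
    rw [rotFwd_a, iHom_a, iHom_sigma]
    exact hl.symm

/-- The map from `B(Ãₙ) ⋊ ℤ` to `B(B_{n+1})`. -/
def ofAff : BraidAff n ⋊[rotAct n] Multiplicative ℤ →* BraidB n :=
  SemidirectProduct.lift (iHom n) (zpowersHom _ (phiB n))
    (comp_act_eq_conj_comp closure_ofAdd_one (by
      rintro s rfl x
      rw [rotAct_one, rotAut_apply, iHom_rotFwd]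
      simp))

/-- The `t`-exponent sum on `B(B_{n+1})`. -/
def tDegree : BraidB n →* Multiplicative ℤ := rightHom.comp (toAff n)

theorem tDegree_sigma (i : Fin n) : tDegree n (sigmaB i) = 1 := by
  rw [tDegree, MonoidHom.comp_apply, toAff_sigma, rightHom_inl]

theorem tDegree_FElt (k : Fin (n + 1)) : tDegree n (FElt n k) = Multiplicative.ofAdd 1 := by
  induction k using Fin.induction with
  | zero =>
    rw [FElt_zero, tDegree, MonoidHom.comp_apply, toAff_t, map_mul, map_inv, rightHom_inl,
      rightHom_inr, inv_one, mul_one]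
  | succ k ih => rw [FElt_succ, map_mul, map_mul, map_inv, ih, tDegree_sigma]; simp

theorem iHom_spec : Function.Injective (iHom n) ∧ (iHom n).range = (tDegree n).ker := by
  have e1 : (ofAff n).comp inl = iHom n := lift_comp_inl _ _ _
  have h := injective_and_range_of_retract (A := toAff n) (B := ofAff n)
    (by
      apply BraidB.hom_ext
      · intro i
        rw [MonoidHom.comp_apply, toAff_sigma, ofAff, lift_inl, iHom_sigma, MonoidHom.id_apply]
      · rw [MonoidHom.comp_apply, toAff_t, map_mul, map_inv, ofAff, lift_inl, lift_inr, map_ascProd]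
        simp only [iHom_sigma, MonoidHom.id_apply, zpowersHom_apply, toAdd_ofAdd, zpow_one]
        exact mul_inv_cancel_right _ _)
    (by
      rw [MonoidHom.comp_assoc, e1]
      apply BraidAff.hom_ext
      · intro i
        rw [MonoidHom.comp_apply, iHom_sigma, toAff_sigma]
      · rw [MonoidHom.comp_apply, iHom_a, map_mul, map_mul, map_inv, toAff_phi, toAff_sigma,
          inr_mul_inl_mul_inv, rotAct_one, rotAut_apply,
          rotFwd_last n (by simp only [lastIdx]; have := NeZero.ne n; omega)])
  rwa [e1] at h

end Affine

/-! ### The homomorphism `f` and its kernel -/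

section Kernel

variable (n : ℕ) [NeZero n]

theorem fHom_sigma (i : Fin n) : fHom n (sigmaAff i) = sigmaA i := PresentedGroup.toGroup.of _

theorem fHom_a : fHom n (aAff n) = bWord sigmaA := PresentedGroup.toGroup.of _

/-- Setting t = 1 turns φσₙφ⁻¹ into the conjugate of σₙ by σ₁⋯σₙ, which `bWord_eq` identifies with
the image of a_{n+1} under f. -/
theorem alphaHom_comp_iHom : (alphaHom n).comp (iHom n) = fHom n := by
  apply BraidAff.hom_ext
  · intro i
    rw [MonoidHom.comp_apply, iHom_sigma, alphaHom_sigma, fHom_sigma]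
  · rw [MonoidHom.comp_apply, iHom_a, fHom_a, ← bWord_eq _ (braidFam_sigmaA n)]
    simp only [phiB, map_mul, map_inv, alphaHom_t, alphaHom_sigma, map_ascProd, one_mul]

theorem fHom_surjective : Function.Surjective (fHom n) := by
  rw [← MonoidHom.range_eq_top, eq_top_iff, ← PresentedGroup.closure_range_of,
    Subgroup.closure_le]
  rintro _ ⟨i, rfl⟩
  exact ⟨sigmaAff i, fHom_sigma n i⟩

theorem fHom_eElt : fHom n (eElt n) = 1 := by
  rw [eElt, map_mul, map_inv, fHom_a, map_bWord]
  simp only [fHom_sigma, inv_mul_cancel]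

instance : (NSub n).Normal := Subgroup.normalClosure_normal

/-- The section of `f` modulo `N_e`. -/
def quotientSection : BraidA n →* BraidAff n ⧸ NSub n :=
  PresentedGroup.toGroup (rels := {r | ARel n r})
    (f := fun i => QuotientGroup.mk' (NSub n) (sigmaAff i)) (by
      intro r hr
      cases hr with
      | comm i j h =>
        rw [map_commRel, commRel_eq_one]
        simp only [FreeGroup.lift_apply_of, ← map_mul, (braidFam_sigmaAff n).comm i j h]
      | braid i j h =>
        rw [map_braidRel, braidRel_eq_one]
        have : sigmaAff i * sigmaAff j * sigmaAff i = sigmaAff j * sigmaAff i * sigmaAff j :=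
          (braidFam_sigmaAff n).braid i j h
        simp only [FreeGroup.lift_apply_of, Br, ← map_mul, this])

theorem quotientSection_sigma (i : Fin n) :
    quotientSection n (sigmaA i) = QuotientGroup.mk' (NSub n) (sigmaAff i) :=
  PresentedGroup.toGroup.of _

/-- Modulo e, a_{n+1} equals its prescribed word in the `σ_i`. The quotient map thus factors through
f, whence ker f ≤ N_e. -/
theorem quotientSection_comp_fHom :
    (quotientSection n).comp (fHom n) = QuotientGroup.mk' (NSub n) := by
  apply BraidAff.hom_ext
  · intro i
    rw [MonoidHom.comp_apply, fHom_sigma, quotientSection_sigma]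
  · rw [MonoidHom.comp_apply, fHom_a, map_bWord]
    simp only [quotientSection_sigma]
    rw [← map_bWord]
    have h : QuotientGroup.mk' (NSub n) (eElt n) = 1 :=
      (QuotientGroup.eq_one_iff _).2 (Subgroup.subset_normalClosure (Set.mem_singleton _))
    rw [eElt, map_mul, map_inv, inv_mul_eq_one] at h
    exact h.symm

theorem ker_fHom : (fHom n).ker = NSub n := by
  apply le_antisymm
  · intro x hx
    have h := DFunLike.congr_fun (quotientSection_comp_fHom n) x
    rw [MonoidHom.comp_apply, MonoidHom.mem_ker.1 hx, map_one] at h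
    exact (QuotientGroup.eq_one_iff x).1 h.symm
  · apply Subgroup.normalClosure_le_normal
    rintro _ rfl
    exact fHom_eElt n

/-- Both sides are the intersection of ker α with the kernel of the t-degree, which on ker α is the
exponent sum in the `F_k`. -/
theorem map_NSub_iHom :
    (NSub n).map (iHom n) = (expSum (Fin (n + 1))).ker.map (freeHom n) := by
  have hdeg : (tDegree n).comp (freeHom n) = expSum (Fin (n + 1)) := by
    ext k
    simp [freeHom, expSum, tDegree_FElt]
  have hdeg' : ∀ y, tDegree n (freeHom n y) = expSum (Fin (n + 1)) y :=
    fun y => DFunLike.congr_fun hdeg y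
  have hα : ∀ y, alphaHom n (iHom n y) = fHom n y :=
    fun y => DFunLike.congr_fun (alphaHom_comp_iHom n) y
  rw [← ker_fHom]
  ext x
  constructor
  · rintro ⟨y, hy, rfl⟩
    have h1 : iHom n y ∈ (freeHom n).range := by
      rw [(freeHom_spec n).2, MonoidHom.mem_ker, hα]
      exact hy
    have h2 : iHom n y ∈ (tDegree n).ker := (iHom_spec n).2 ▸ ⟨y, rfl⟩
    obtain ⟨z, hz⟩ := h1
    refine ⟨z, ?_, hz⟩
    change expSum _ z = 1
    rw [← hdeg', hz]
    exact h2
  · rintro ⟨z, hz, rfl⟩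
    have h1 : freeHom n z ∈ (iHom n).range := by
      rw [(iHom_spec n).2, MonoidHom.mem_ker, hdeg']
      exact hz
    have h2 : freeHom n z ∈ (alphaHom n).ker := (freeHom_spec n).2 ▸ ⟨z, rfl⟩
    obtain ⟨y, hy⟩ := h1
    refine ⟨y, ?_, hy⟩
    change fHom n y = 1
    rw [← hα, hy]
    exact h2

/-- The free basis of `N_e`. -/
theorem exists_basis_NSub : ∃ b : FreeGroupBasis (ℤ × Fin n) (NSub n),
    ∀ (j : ℤ) (k : Fin n), iHom n (b (j, k) : BraidAff n) =
      FElt n 0 ^ j * FElt n k.succ * FElt n 0 ^ (-(j + 1)) := by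
  have hinj : Function.Injective ((freeHom n).comp (sumZeroHom n)) :=
    (freeHom_spec n).1.comp (sumZeroHom_spec n).1
  have hrange : ((freeHom n).comp (sumZeroHom n)).range = (NSub n).map (iHom n) := by
    rw [map_NSub_iHom, MonoidHom.range_comp, (sumZeroHom_spec n).2]
  obtain ⟨b, hb⟩ := exists_freeGroupBasis hinj hrange
  -- The basis `b` lives on the image of N_e and is pulled back along the injective i.
  let e := (NSub n).equivMapOfInjective (iHom n) (iHom_spec n).1
  refine ⟨b.map e.symm, fun j k => ?_⟩
  have h1 : ∀ y, iHom n (e.symm y : BraidAff n) = y := fun y => by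
    have := (NSub n).coe_equivMapOfInjective_apply (iHom n) (iHom_spec n).1 (e.symm y)
    rw [← this]
    exact congrArg Subtype.val (e.apply_symm_apply y)
  rw [FreeGroupBasis.map_apply, h1, hb]
  simp only [MonoidHom.comp_apply, sumZeroHom, freeHom, FreeGroup.lift_apply_of, map_mul,
    map_zpow]

end Kernel

end AffineBraid

open AffineBraid
theorem mainTheorem3 (n : ℕ) [NeZero n] :
    -- `N_e` is the kernel of the surjection `f`, which factors as `α ∘ i` with `i` injective
    Function.Surjective (fHom n) ∧ (fHom n).ker = NSub n ∧
    Function.Injective (iHom n) ∧ (alphaHom n).comp (iHom n) = fHom n ∧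
    -- `ker α` is free on `F₀, …, Fₙ`
    (∃ b : FreeGroupBasis (Fin (n + 1)) (alphaHom n).ker,
      ∀ k, (b k : BraidB n) = FElt n k) ∧
    -- `N_e` is the exponent-sum-zero subgroup of `ker α`
    ((NSub n).map (iHom n) : Set (BraidB n)) = exponentSumZero (FElt n) ∧
    -- `N_e` is free on the `F₀ʲ F_k F₀^{-(j+1)}`, `j ∈ ℤ`, `1 ≤ k ≤ n`
    (∃ b : FreeGroupBasis (ℤ × Fin n) (NSub n),
      ∀ (j : ℤ) (k : Fin n), iHom n (b (j, k) : BraidAff n) =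
        FElt n 0 ^ j * FElt n k.succ * FElt n 0 ^ (-(j + 1))) ∧
    -- `N_e` is not finitely generated
    ¬ Group.FG (NSub n) := by
  refine ⟨fHom_surjective n, ker_fHom n, (iHom_spec n).1, alphaHom_comp_iHom n, ?_, ?_,
    exists_basis_NSub n, ?_⟩
  · obtain ⟨b, hb⟩ := exists_freeGroupBasis (freeHom_spec n).1 (freeHom_spec n).2
    exact ⟨b, fun k => by rw [hb, freeHom, FreeGroup.lift_apply_of]⟩
  · rw [map_NSub_iHom]
    exact map_ker_expSum (FElt n)
  · obtain ⟨b, -⟩ := exists_basis_NSub n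
    -- The index set ℤ × {1, …, n} is infinite because n ≥ 1.
    exact not_fg_of_freeGroupBasis b
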